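/- Let $G=(V,E)$ be a finite connected simple graph (no loops, no parallel edges), with at least one vertex, and let $p,q,r\in\mathbb R$. For $\eta\in\mathbb N^V$, where $\mathbb N=\{0,1,2,\dots\}$, let $\eta^{+v}$ be $\eta$ with one particle added at $v$; if $\eta_v\ge 1$, let $\eta^{-v}$ be $\eta$ with one particle removed at $v$, and, for a neighbour $u$ of $v$, let $\eta^{vu}$ be $\eta$ with one particle moved from $v$ to $u$. Let $H=(H(n))_{n\ge 0}$ be a *non-conservative zero range process*, i.e. a Markov chain on $\mathbb N^V$ with $H(0)\neq 0$ almost surely and with transition probabilities $$\mathbb P[H(n+1)=\eta^{+v}\mid H(n)=\eta]=\frac{\eta_v^p}{Z(\eta)},\qquad \mathbb P[H(n+1)=\eta^{-v}\mid H(n)=\eta]=\frac{\eta_v^q}{Z(\eta)},\qquad \mathbb P[H(n+1)=\eta^{vu}\mid H(n)=\eta]=\frac{\eta_v^r}{Z(\eta)}\quad(u\sim v),$$ where $Z(\eta)=\sum_{w\in V}\big[\eta_w^p+\eta_w^q+\deg(w)\,\eta_w^r\big]$, with the conventions $0^p=1$, $0^q=0$, $0^r=0$ in these formulas (whatever the values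 of $p,q,r$). Let $\mathrm{Creat}$ be the event that there is $m\in\mathbb N$ such that for every $n\ge m$ there is a vertex $v(n)$ with $H(n+1)=H(n)^{+v(n)}$. Let $\mathrm{Mon}$ be the event that there is a unique vertex $w$ for which there is $m\in\mathbb N$ such that, for all $n\ge m$, $H_w(n+1)=H_w(n)+1$ and $H_v(n+1)=H_v(n)$ for all $v\ne w$. Then: 1. if $G$ has at least two vertices and $p\le 1+\max\{q,r\}$, then $\mathbb P(\mathrm{Creat})=0$; 2. if $p>1+\max\{q,r,0\}$, then $\mathbb P(\mathrm{Creat})=1$ and $\mathbb P(\mathrm{Mon})=1$. -/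

import Mathlib

open MeasureTheory

noncomputable section

namespace NCZR

variable {V : Type*} [Fintype V] [DecidableEq V]

/-- The weight `k ^ p` of a creation at a site with `k` particles, with the convention
`0 ^ p = 1` for every real `p`. -/
def createWeight (p : ℝ) (k : ℕ) : ℝ := if k = 0 then 1 else (k : ℝ) ^ p

/-- The weight `k ^ s` of an annihilation (`s = q`) or of a jump to a given neighbour (`s = r`)
at a site with `k` particles, with the convention `0 ^ s = 0` for every real `s`. -/
def removeWeight (s : ℝ) (k : ℕ) : ℝ := if k = 0 then 0 else (k : ℝ) ^ s

/-- The configuration `η^{+v}`: a particle is created at `v`. -/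
def create (η : V → ℕ) (v : V) : V → ℕ := Function.update η v (η v + 1)

/-- The configuration `η^{-v}`: a particle is annihilated at `v` (meaningful if `1 ≤ η v`). -/
def annihilate (η : V → ℕ) (v : V) : V → ℕ := Function.update η v (η v - 1)

/-- The configuration `η^{vu}`: a particle jumps from `v` to `u ≠ v`
(meaningful if `1 ≤ η v`). -/
def jump (η : V → ℕ) (v u : V) : V → ℕ :=
  Function.update (Function.update η v (η v - 1)) u (η u + 1)

/-- The normalising constant `∑_w [η_w^p + η_w^q + deg(w) η_w^r]`. -/
def totalRate (G : SimpleGraph V) [DecidableRel G.Adj] (p q r : ℝ) (η : V → ℕ) : ℝ :=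
  ∑ w, (createWeight p (η w) + removeWeight q (η w) + (G.degree w : ℝ) * removeWeight r (η w))

/-- The one-step transition probability from `η` to `ξ`. The configurations `η^{+v}`, and
`η^{-v}`, `η^{vu}` for `1 ≤ η v` and `u` adjacent to `v`, are pairwise distinct, so at most one
summand is nonzero; the removal weights vanish at the sites with `η v = 0`. -/
def transitionProb (G : SimpleGraph V) [DecidableRel G.Adj] (p q r : ℝ) (η ξ : V → ℕ) : ℝ :=
  ((∑ v, if ξ = create η v then createWeight p (η v) else 0)
    + (∑ v, if ξ = annihilate η v then removeWeight q (η v) else 0)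
    + ∑ v, ∑ u ∈ G.neighborFinset v, if ξ = jump η v u then removeWeight r (η v) else 0)
  / totalRate G p q r η

/-- `H` is, under `P`, a non-conservative zero range process on `G` with parameters `p, q, r`:
a Markov chain on `V → ℕ` with the above transition probabilities, started from a nonzero
(possibly random) configuration. -/
structure IsNCZR (G : SimpleGraph V) [DecidableRel G.Adj] (p q r : ℝ)
    {Ω : Type*} [MeasurableSpace Ω] (P : Measure Ω) (H : ℕ → Ω → V → ℕ) : Prop where
  measurable : ∀ n, Measurable (H n)
  initial_ne_zero : ∀ᵐ ω ∂P, H 0 ω ≠ 0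
  markov : ∀ (n : ℕ) (η : ℕ → V → ℕ),
    P.real {ω | ∀ k ≤ n + 1, H k ω = η k} =
      P.real {ω | ∀ k ≤ n, H k ω = η k} * transitionProb G p q r (η n) (η (n + 1))

/-- The trajectories for which, from some time on, every step is a creation. -/
def Creat : Set (ℕ → V → ℕ) :=
  {h | ∃ m : ℕ, ∀ n ≥ m, ∃ v : V, h (n + 1) = create (h n) v}

/-- The trajectories for which there is a unique site `w` such that, from some time on, every
step is a creation at `w`, all other sites being frozen. -/
def Mon : Set (ℕ → V → ℕ) :=
  {h | ∃! w : V, ∃ m : ℕ, ∀ n ≥ m,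
    h (n + 1) w = h n w + 1 ∧ ∀ v, v ≠ w → h (n + 1) v = h n v}

end NCZR

end

/-!
Everything is done on path space: the law `μ` of the trajectory is determined by the
probabilities of initial segments (`pathCylinder`), and only creations matter. The kernel
`creationKernel` keeps the creations at the sites of a prescribed set and kills all other
transitions; its iterates are the conditional probabilities of runs of allowed creations
(`measureReal_pathCylinder_inter_creating`). Conditional bounds on events are turned into null
events by a form of Lévy's zero-one law: an event whose conditional probability given every late
past is at most `c < 1` is null (`measure_eq_zero_of_pathCylinder_bound`).

*No perpetual creation if `p ≤ 1 + max q r`.* Every empty site can be filled only once by a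
process that only creates, so eventually all creations occur at occupied sites. With `N`
particles on a graph without isolated vertices, the rate of creation at occupied sites is at most
`N` times the rate of the other transitions, because `k ^ p ≤ k * k ^ max q r` for `1 ≤ k ≤ N`.
Hence such a creation has probability at most `N / (N + 1)`, and a run of them, along which `N`
increases by one at each step, has probability tending to `0` with its length.

*Perpetual creation if `p > 1 + max q r 0`.* With `N` particles the ratio of the rate of the other
transitions to that of the creations is `O(N ^ (-t))` with `t = p - max q r 0 > 1`. This is
summable in `N`, so perpetual creation has probability at least some `δ > 0` from every
configuration, hence occurs almost surely by the zero-one law.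

*Monopoly.* Let `x, y` be the contents of two sites and `c k = k ^ p` the creation weight. As long
as only creations occur, `D = ∑_{j ≥ y} 1 / c j - ∑_{j ≥ x} 1 / c j` is a martingale, and so is
`M = D ^ 2 + S`, where `S = ∑_{j ≥ x} 1 / (c j) ^ 2 + ∑_{j ≥ y} 1 / (c j) ^ 2`. Moreover
`W = M ^ 2 + 8 M S + 8 S ^ 2` is a supermartingale with `M ^ 2 ≤ W ≤ 17 M ^ 2`
(`quadForm_drift`, `quadForm_le`). If both sites grow indefinitely then `M → 0`, which by the
second moment method has conditional probability at most `16 / 17` from every configuration.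
This is implemented by the superharmonic function `barrier = 1 - 2 κ M + κ ^ 2 W`, which is
nonnegative, at most `16 / 17` at the start for a suitable `κ`, and tends to `1` when both sites
grow. By the zero-one law no two sites grow indefinitely, so a single one receives all late
particles.
-/

open Filter Topology Function

namespace NCZR

/-! ### Events on path space -/

section PathMeasure

/-- The set of trajectories that agree with `a` up to and including time `n`. -/
def pathCylinder {S : Type*} (n : ℕ) (a : ℕ → S) : Set (ℕ → S) := {h | ∀ k ≤ n, h k = a k}

variable {S : Type*} [Countable S] [MeasurableSpace S] [MeasurableSingletonClass S]

omit [Countable S] in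
lemma measurableSet_pathCylinder (n : ℕ) (a : ℕ → S) : MeasurableSet (pathCylinder n a) := by
  have : pathCylinder n a = ⋂ k, ⋂ (_ : k ≤ n), (fun h : ℕ → S => h k) ⁻¹' {a k} := by
    ext h; simp [pathCylinder]
  rw [this]
  exact MeasurableSet.iInter fun k => MeasurableSet.iInter fun _ =>
    measurable_pi_apply k (measurableSet_singleton _)

lemma measurableSet_step (k : ℕ) (R : S → S → Prop) :
    MeasurableSet {h : ℕ → S | R (h k) (h (k + 1))} := by
  have hm : Measurable fun h : ℕ → S => (h k, h (k + 1)) :=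
    (measurable_pi_apply k).prodMk (measurable_pi_apply (k + 1))
  exact hm (Set.to_countable {x : S × S | R x.1 x.2}).measurableSet

/-- An event whose conditional probability given the past stays below a constant `c < 1` at
all late times is null: it can be approximated by events depending on finitely many coordinates. -/
lemma measure_eq_zero_of_pathCylinder_bound [Nonempty S] (μ : Measure (ℕ → S))
    [IsProbabilityMeasure μ] {E : Set (ℕ → S)} (hE : MeasurableSet E) (m : ℕ) {c : ℝ} (hc0 : 0 ≤ c) (hc : c < 1)
    (hbound : ∀ n ≥ m, ∀ a, μ.real (E ∩ pathCylinder n a) ≤ c * μ.real (pathCylinder n a)) :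
    μ E = 0 := by
  have hcyl : ∀ t ∈ measurableCylinders (fun _ : ℕ => S), μ.real (E ∩ t) ≤ c * μ.real t := by
    intro t ht
    obtain ⟨s, T, hT, rfl⟩ := (mem_measurableCylinders _).1 ht
    obtain ⟨n, hmn, hn⟩ : ∃ n ≥ m, ∀ k ∈ s, k ≤ n :=
      ⟨max m (s.sup id), le_max_left _ _,
        fun k hk => le_max_of_le_right (Finset.le_sup (f := id) hk)⟩
    let π : (ℕ → S) → (Set.Iic n → S) := fun h k => h k
    have hπ : Measurable π := by fun_prop
    let T' : Set (Set.Iic n → S) := {x | (fun k : s => x ⟨k, hn k k.2⟩) ∈ T}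
    have hTT : cylinder s T = π ⁻¹' T' := rfl
    have hfib : ∀ x : Set.Iic n → S, ∃ a : ℕ → S, π ⁻¹' {x} = pathCylinder n a := by
      intro x
      refine ⟨fun k => if hk : k ≤ n then x ⟨k, hk⟩ else Classical.arbitrary S, ?_⟩
      ext h
      simp only [Set.mem_preimage, Set.mem_singleton_iff, funext_iff, pathCylinder,
        Set.mem_ofPred_eq, π]
      constructor
      · intro hx k hk
        simp [hk, ← hx]
      · rintro hx ⟨k, hk⟩
        simpa [Set.mem_Iic.1 hk] using hx k hk
    have hmeas : ∀ A : Set (Set.Iic n → S), MeasurableSet A :=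
      fun A => (Set.to_countable A).measurableSet
    have hle : (μ.restrict E).map π ≤ ENNReal.ofReal c • μ.map π := by
      refine Measure.le_iff.2 fun A hA => ?_
      have hun : ∀ ν : Measure (Set.Iic n → S), ν A = ∑' x : A, ν {x.1} := by
        intro ν
        conv_lhs => rw [← Set.biUnion_of_singleton A]
        exact measure_biUnion (Set.to_countable A)
          (fun x _ y _ hxy => Set.disjoint_singleton.2 hxy) (fun x _ => hmeas _)
      rw [hun, hun]
      refine ENNReal.tsum_le_tsum fun x => ?_
      obtain ⟨a, ha⟩ := hfib x
      rw [Measure.smul_apply, Measure.map_apply hπ (hmeas _), Measure.map_apply hπ (hmeas _), ha,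
        Measure.restrict_apply (measurableSet_pathCylinder n a), Set.inter_comm, smul_eq_mul,
        ← ofReal_measureReal, ← ofReal_measureReal, ← ENNReal.ofReal_mul hc0]
      exact ENNReal.ofReal_le_ofReal (hbound n hmn a)
    have := hle T'
    rw [Measure.smul_apply, Measure.map_apply hπ (hmeas _), Measure.map_apply hπ (hmeas _),
      Measure.restrict_apply (hπ (hmeas _)), Set.inter_comm, smul_eq_mul,
      ← ofReal_measureReal, ← ofReal_measureReal, ← ENNReal.ofReal_mul hc0] at this
    rw [hTT]
    exact (ENNReal.ofReal_le_ofReal_iff (by positivity)).1 this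
  have hdense := Measure.MeasureDense.of_generateFrom_isSetAlgebra_finite (μ := μ)
    (isSetAlgebra_measurableCylinders) generateFrom_measurableCylinders.symm
  have hreal : μ.real E ≤ 0 := by
    have key : ∀ ε > 0, (1 - c) * μ.real E ≤ 2 * ε := by
      intro ε hε
      obtain ⟨t, ht, hst⟩ := hdense.approx E hE (measure_ne_top _ _) ε hε
      have htm : MeasurableSet t := hdense.measurable t ht
      have h1 : μ.real (symmDiff E t) < ε := by
        rw [measureReal_def]
        exact ENNReal.toReal_lt_of_lt_ofReal hst
      have h2 : μ.real E ≤ μ.real (E ∩ t) + μ.real (symmDiff E t) := by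
        rw [← measureReal_inter_add_sdiff (s := E) (t := t) htm]
        gcongr
        · exact measure_ne_top _ _
        · exact fun x hx => Or.inl hx
      have h3 : μ.real t ≤ μ.real E + μ.real (symmDiff E t) := by
        refine (measureReal_mono ?_).trans (measureReal_union_le _ _)
        intro x hx
        by_cases hxE : x ∈ E
        · exact Or.inl hxE
        · exact Or.inr (Or.inr ⟨hx, hxE⟩)
      have h4 := hcyl t ht
      have h5 : c * μ.real t ≤ c * (μ.real E + μ.real (symmDiff E t)) := by gcongr
      have h6 : c * μ.real (symmDiff E t) ≤ 1 * μ.real (symmDiff E t) := by gcongr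
      linarith
    by_contra! hpos
    have hp : 0 < (1 - c) * μ.real E := mul_pos (by linarith) hpos
    have := key ((1 - c) * μ.real E / 4) (by linarith)
    linarith
  have h0 : μ.real E = 0 := le_antisymm hreal measureReal_nonneg
  exact (measureReal_eq_zero_iff).1 h0

end PathMeasure

variable {V : Type*} [Fintype V] [DecidableEq V]

/-! ### Creations and the creation kernel -/

section Creation

lemma createWeight_pos (p : ℝ) (k : ℕ) : 0 < createWeight p k := by
  unfold createWeight
  split_ifs with h
  · exact one_pos
  · exact Real.rpow_pos_of_pos (by exact_mod_cast Nat.pos_of_ne_zero h) p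

lemma removeWeight_nonneg (s : ℝ) (k : ℕ) : 0 ≤ removeWeight s k := by
  unfold removeWeight
  split_ifs with h
  · exact le_rfl
  · positivity

omit [DecidableEq V] in
lemma sum_createWeight_le_totalRate (G : SimpleGraph V) [DecidableRel G.Adj] (p q r : ℝ)
    (η : V → ℕ) : ∑ w, createWeight p (η w) ≤ totalRate G p q r η := by
  unfold totalRate
  refine Finset.sum_le_sum fun w _ => ?_
  have h1 := removeWeight_nonneg q (η w)
  have h2 := mul_nonneg (Nat.cast_nonneg (α := ℝ) (G.degree w)) (removeWeight_nonneg r (η w))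
  linarith

omit [DecidableEq V] in
lemma totalRate_pos [Nonempty V] (G : SimpleGraph V) [DecidableRel G.Adj] (p q r : ℝ)
    (η : V → ℕ) : 0 < totalRate G p q r η :=
  (Finset.sum_pos (fun w _ => createWeight_pos p (η w)) Finset.univ_nonempty).trans_le
    (sum_createWeight_le_totalRate G p q r η)

omit [Fintype V] in
lemma create_injective (η : V → ℕ) : Injective (create η) := by
  intro v w h
  by_contra hvw
  have := congrFun h v
  simp [create, hvw] at this

lemma sum_create (η : V → ℕ) (v : V) : ∑ w, create η v w = ∑ w, η w + 1 := by
  rw [create, Finset.sum_update_of_mem (Finset.mem_univ v),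
    ← Finset.add_sum_erase _ _ (Finset.mem_univ v), Finset.sdiff_singleton_eq_erase]
  ring

lemma sum_annihilate_le (η : V → ℕ) (v : V) : ∑ w, annihilate η v w ≤ ∑ w, η w := by
  refine Finset.sum_le_sum fun w _ => ?_
  rcases eq_or_ne w v with rfl | h
  · simp [annihilate]
  · simp [annihilate, h]

lemma sum_jump (η : V → ℕ) {v u : V} (hvu : u ≠ v) (hv : η v ≠ 0) :
    ∑ w, jump η v u w = ∑ w, η w := by
  have h : create (annihilate η v) u = jump η v u := by
    simp [create, annihilate, jump, hvu]
  have h' : create (annihilate η v) v = η := by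
    ext w
    rcases eq_or_ne w v with rfl | hw
    · simp [create, annihilate]; omega
    · simp [create, annihilate, hw]
  rw [← h, sum_create, ← sum_create _ v, h']

lemma transitionProb_create (G : SimpleGraph V) [DecidableRel G.Adj] (p q r : ℝ)
    (η : V → ℕ) (v : V) :
    transitionProb G p q r η (create η v) = createWeight p (η v) / totalRate G p q r η := by
  have h1 : (∑ w, if create η v = create η w then createWeight p (η w) else 0)
      = createWeight p (η v) := by
    simp [(create_injective η).eq_iff]
  have h2 : (∑ w, if create η v = annihilate η w then removeWeight q (η w) else 0) = 0 := by
    refine Finset.sum_eq_zero fun w _ => if_neg fun h => ?_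
    have := sum_annihilate_le η w
    rw [← h, sum_create] at this
    omega
  have h3 : (∑ w, ∑ u ∈ G.neighborFinset w,
      if create η v = jump η w u then removeWeight r (η w) else 0) = 0 := by
    refine Finset.sum_eq_zero fun w _ => Finset.sum_eq_zero fun u hu => ?_
    by_cases hw : η w = 0
    · simp [removeWeight, hw]
    · refine if_neg fun h => ?_
      have := sum_jump η (G.ne_of_adj ((G.mem_neighborFinset w u).1 hu)).symm hw
      rw [← h, sum_create] at this
      omega
  rw [transitionProb, h1, h2, h3, add_zero, add_zero]

/-- The one-step expectation of `f` over the transitions that create a particle at a site of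
`s η`, all other transitions being discarded. -/
noncomputable def creationKernel (G : SimpleGraph V) [DecidableRel G.Adj] (p q r : ℝ)
    (s : (V → ℕ) → Finset V) (f : (V → ℕ) → ℝ) (η : V → ℕ) : ℝ :=
  ∑ v ∈ s η, createWeight p (η v) / totalRate G p q r η * f (create η v)

/-- The trajectories `h` for which each of the `n` steps after time `m` creates a particle at a
site allowed by `s`. -/
def creating (s : (V → ℕ) → Finset V) (m n : ℕ) : Set (ℕ → V → ℕ) :=
  {h | ∀ k, m ≤ k → k < m + n → ∃ v ∈ s (h k), h (k + 1) = create (h k) v}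

lemma measurableSet_creating (s : (V → ℕ) → Finset V) (m n : ℕ) :
    MeasurableSet (creating s m n) := by
  have : creating s m n = ⋂ k, ⋂ (_ : m ≤ k), ⋂ (_ : k < m + n),
      {h | ∃ v ∈ s (h k), h (k + 1) = create (h k) v} := by
    ext h; simp [creating]
  rw [this]
  exact MeasurableSet.iInter fun k => MeasurableSet.iInter fun _ => MeasurableSet.iInter fun _ =>
    measurableSet_step k fun η ξ => ∃ v ∈ s η, ξ = create η v

omit [DecidableEq V] in
lemma measurableSet_eval_mem (n : ℕ) (D : Set (V → ℕ)) :
    MeasurableSet {h : ℕ → V → ℕ | h n ∈ D} :=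
  measurable_pi_apply n (Set.to_countable D).measurableSet

section Kernel

variable (G : SimpleGraph V) [DecidableRel G.Adj] (p q r : ℝ) (s : (V → ℕ) → Finset V)

lemma creationKernel_mono {f g : (V → ℕ) → ℝ} (h : f ≤ g) :
    creationKernel G p q r s f ≤ creationKernel G p q r s g := by
  intro η
  refine Finset.sum_le_sum fun v _ => mul_le_mul_of_nonneg_left (h _) ?_
  exact div_nonneg (createWeight_pos p _).le
    ((Finset.sum_nonneg fun w _ => (createWeight_pos p (η w)).le).trans
      (sum_createWeight_le_totalRate G p q r η))

/-- Iterating the kernel preserves a family of upper bounds propagated by one step. -/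
lemma iterate_creationKernel_le {f : (V → ℕ) → ℝ} (g : ℕ → (V → ℕ) → ℝ) (hf : f ≤ g 0)
    (hg : ∀ n, creationKernel G p q r s (g n) ≤ g (n + 1)) (n : ℕ) :
    (creationKernel G p q r s)^[n] f ≤ g n := by
  induction n with
  | zero => exact hf
  | succ n ih =>
    rw [iterate_succ_apply']
    exact (creationKernel_mono G p q r s ih).trans (hg n)

lemma le_iterate_creationKernel {f g : (V → ℕ) → ℝ} (hf : g ≤ f)
    (hg : g ≤ creationKernel G p q r s g) (n : ℕ) :
    g ≤ (creationKernel G p q r s)^[n] f := by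
  induction n with
  | zero => exact hf
  | succ n ih =>
    rw [iterate_succ_apply']
    exact hg.trans (creationKernel_mono G p q r s ih)

/-- The Markov property along creations: given the trajectory up to time `m`, the probability
that the next `n` steps are allowed creations leading into `D` is an iterate of the kernel. -/
lemma measureReal_pathCylinder_inter_creating (μ : Measure (ℕ → V → ℕ)) [IsProbabilityMeasure μ]
    (hμ : ∀ n a, μ.real (pathCylinder (n + 1) a) =
      μ.real (pathCylinder n a) * transitionProb G p q r (a n) (a (n + 1)))
    (D : Set (V → ℕ)) (n m : ℕ) (a : ℕ → V → ℕ) :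
    μ.real (pathCylinder m a ∩ creating s m n ∩ {h | h (m + n) ∈ D}) =
      μ.real (pathCylinder m a) * (creationKernel G p q r s)^[n] (D.indicator 1) (a m) := by
  induction n generalizing m a with
  | zero =>
    by_cases hD : a m ∈ D
    · have : pathCylinder m a ∩ creating s m 0 ∩ {h | h (m + 0) ∈ D} = pathCylinder m a := by
        ext h
        simp only [Set.mem_inter_iff, Set.mem_ofPred_eq, creating, add_zero]
        constructor
        · exact fun hh => hh.1.1
        · intro hh
          refine ⟨⟨hh, fun k h1 h2 => absurd h1 (by omega)⟩, ?_⟩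
          rwa [hh m le_rfl]
      rw [this]; simp [hD]
    · have : pathCylinder m a ∩ creating s m 0 ∩ {h | h (m + 0) ∈ D} = ∅ := by
        ext h
        simp only [Set.mem_inter_iff, Set.mem_ofPred_eq, add_zero, Set.mem_empty_iff_false,
          iff_false]
        rintro ⟨⟨hh, -⟩, h2⟩
        rw [hh m le_rfl] at h2
        exact hD h2
      rw [this]; simp [hD]
  | succ n ih =>
    let b : V → ℕ → V → ℕ := fun v => update a (m + 1) (create (a m) v)
    have hb : ∀ v, b v (m + 1) = create (a m) v := fun v => by simp [b]
    have hb' : ∀ v, ∀ k ≤ m, b v k = a k := fun v k hk => by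
      simp [b, update_of_ne (show k ≠ m + 1 by omega)]
    have hpre : ∀ v, pathCylinder m (b v) = pathCylinder m a := by
      intro v; ext h
      exact forall₂_congr fun k hk => by rw [hb' v k hk]
    have hset : pathCylinder m a ∩ creating s m (n + 1) ∩ {h | h (m + (n + 1)) ∈ D} =
        ⋃ v ∈ s (a m), pathCylinder (m + 1) (b v) ∩ creating s (m + 1) n ∩
          {h | h (m + 1 + n) ∈ D} := by
      ext h
      simp only [Set.mem_inter_iff, Set.mem_ofPred_eq, Set.mem_iUnion, exists_prop,
        show m + (n + 1) = m + 1 + n by omega]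
      constructor
      · rintro ⟨⟨h1, h2⟩, h3⟩
        obtain ⟨v, hv, hv'⟩ := h2 m le_rfl (by omega)
        rw [h1 m le_rfl] at hv hv'
        refine ⟨v, hv, ⟨fun k hk => ?_, fun k hk hk' => h2 k (by omega) (by omega)⟩, h3⟩
        rcases Nat.le_succ_iff.1 hk with hk | rfl
        · rw [hb' v k hk, h1 k hk]
        · rw [Nat.succ_eq_add_one, hb, hv']
      · rintro ⟨v, hv, ⟨h1, h2⟩, h3⟩
        have h1' : ∀ k ≤ m, h k = a k := fun k hk => by rw [h1 k (by omega), hb' v k hk]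
        refine ⟨⟨h1', fun k hk hk' => ?_⟩, h3⟩
        rcases hk.eq_or_lt with rfl | hk
        · exact ⟨v, by rwa [h1' m le_rfl], by rw [h1' m le_rfl, h1 (m + 1) le_rfl, hb]⟩
        · exact h2 k hk (by omega)
    rw [hset, measureReal_biUnion_finset]
    · rw [iterate_succ_apply', creationKernel, Finset.mul_sum]
      refine Finset.sum_congr rfl fun v _ => ?_
      rw [ih, hμ, hb, hpre, hb' v m le_rfl, transitionProb_create, mul_assoc]
    · intro v _ w _ hvw
      refine Set.disjoint_left.2 fun h h1 h2 => hvw (create_injective (a m) ?_)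
      rw [← hb, ← hb, ← h1.1.1 (m + 1) le_rfl, ← h2.1.1 (m + 1) le_rfl]
    · exact fun v _ => ((measurableSet_pathCylinder _ _).inter (measurableSet_creating _ _ _)).inter
        (measurableSet_eval_mem _ _)

end Kernel

end Creation

/-! ### Trajectories with only creations -/

section Trajectories

omit [Fintype V] in
lemma monotone_of_create {h : ℕ → V → ℕ} {m : ℕ}
    (hm : ∀ n ≥ m, ∃ v : V, h (n + 1) = create (h n) v) (v : V) :
    Monotone fun k => h (k + m) v := by
  refine monotone_nat_of_le_succ fun k => ?_
  obtain ⟨u, hu⟩ := hm (k + m) (by omega)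
  have : k + 1 + m = k + m + 1 := by omega
  rw [this, hu]
  rcases eq_or_ne v u with rfl | h
  · simp [create]
  · simp [create, h]

omit [Fintype V] in
/-- If only creations occur, the content of a site tends to infinity or is eventually constant. -/
lemma tendsto_or_eventually_const {h : ℕ → V → ℕ} {m : ℕ}
    (hm : ∀ n ≥ m, ∃ v : V, h (n + 1) = create (h n) v) (v : V) :
    Tendsto (fun k => h k v) atTop atTop ∨ ∃ l, ∀ᶠ k in atTop, h k v = l := by
  rcases tendsto_atTop_of_monotone (monotone_of_create hm v) with h1 | ⟨l, h1⟩
  · exact Or.inl ((tendsto_add_atTop_iff_nat (f := fun k => h k v) m).1 h1)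
  · refine Or.inr ⟨l, ?_⟩
    have := (tendsto_add_atTop_iff_nat (f := fun k => h k v) m).1 h1
    rwa [nhds_discrete, tendsto_pure] at this

/-- If only creations occur and no two sites grow indefinitely, then a single site receives all
the late particles. -/
lemma mem_mon_of_creat {h : ℕ → V → ℕ} (hc : h ∈ Creat)
    (hpair : ∀ u v : V, u ≠ v →
      ¬ (Tendsto (fun k => h k u) atTop atTop ∧ Tendsto (fun k => h k v) atTop atTop)) :
    h ∈ Mon := by
  obtain ⟨m, hm⟩ := hc
  have hconst : ∃ w : V, ∀ v ≠ w, ∃ l, ∀ᶠ k in atTop, h k v = l := by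
    by_cases hw : ∃ w : V, Tendsto (fun k => h k w) atTop atTop
    · obtain ⟨w, hw⟩ := hw
      exact ⟨w, fun v hv => (tendsto_or_eventually_const hm v).resolve_left
        fun h' => hpair v w hv ⟨h', hw⟩⟩
    · push Not at hw
      obtain ⟨w, -⟩ := hm m le_rfl
      exact ⟨w, fun v _ => (tendsto_or_eventually_const hm v).resolve_left (hw v)⟩
  obtain ⟨w, hw⟩ := hconst
  choose! l hl using hw
  have hev : ∀ᶠ k in atTop, ∀ v, v ≠ w → h k v = l v :=
    eventually_all.2 fun v => by
      by_cases hv : v = w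
      · simp [hv]
      · simpa [hv] using hl v hv
  obtain ⟨m', hm'⟩ := eventually_atTop.1 hev
  refine ⟨w, ⟨max m m', fun n hn => ?_⟩, ?_⟩
  · obtain ⟨v, hv⟩ := hm n (le_of_max_le_left hn)
    have hn' := le_of_max_le_right hn
    have hvw : v = w := by
      by_contra hne
      have h1 := congrFun hv v
      rw [hm' (n + 1) (by omega) v hne, create, update_self, hm' n hn' v hne] at h1
      omega
    subst hvw
    refine ⟨by rw [hv, create, update_self], fun u hu => ?_⟩
    rw [hv, create, update_of_ne hu]
  · rintro w' ⟨m'', h''⟩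
    by_contra hne
    have h1 := (h'' (max m'' m') (le_max_left _ _)).1
    rw [hm' _ (le_max_right _ _) w' hne, hm' _ (by omega) w' hne] at h1
    omega

omit [Fintype V] in
lemma mon_subset_creat : (Mon : Set (ℕ → V → ℕ)) ⊆ Creat := by
  rintro h ⟨w, ⟨m, hm⟩, -⟩
  refine ⟨m, fun n hn => ⟨w, funext fun v => ?_⟩⟩
  obtain ⟨h1, h2⟩ := hm n hn
  rcases eq_or_ne v w with rfl | hv
  · simp [create, h1]
  · simp [create, hv, h2 v hv]

/-- The occupied sites of a configuration. -/
def occupied (η : V → ℕ) : Finset V := Finset.univ.filter fun v => η v ≠ 0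

/-- If only creations occur, then late creations occur at occupied sites. -/
lemma exists_creating_occupied {h : ℕ → V → ℕ} (hc : h ∈ Creat) :
    ∃ m, ∀ n, h ∈ creating occupied m n := by
  obtain ⟨m, hm⟩ := hc
  have hev : ∀ᶠ k in atTop, ∀ v, h k v = 0 → h (k + 1) v = 0 := by
    refine eventually_all.2 fun v => ?_
    rcases tendsto_or_eventually_const hm v with h1 | ⟨l, h1⟩
    · filter_upwards [h1.eventually_ge_atTop 1] with k hk hk'
      omega
    · filter_upwards [h1, (tendsto_add_atTop_nat 1).eventually h1] with k hk hk' h0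
      omega
  obtain ⟨m', hm'⟩ := eventually_atTop.1 hev
  refine ⟨max m m', fun n k hk _ => ?_⟩
  obtain ⟨v, hv⟩ := hm k (le_of_max_le_left hk)
  refine ⟨v, ?_, hv⟩
  simp only [occupied, Finset.mem_filter, Finset.mem_univ, true_and]
  intro h0
  have := hm' k (le_of_max_le_right hk) v h0
  simp [hv, create] at this

lemma measurableSet_creat : MeasurableSet (Creat : Set (ℕ → V → ℕ)) := by
  have : (Creat : Set (ℕ → V → ℕ)) = ⋃ m, ⋂ n, ⋂ (_ : n ≥ m),
      {h | ∃ v, h (n + 1) = create (h n) v} := by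
    ext h; simp [Creat]
  rw [this]
  exact MeasurableSet.iUnion fun m => MeasurableSet.iInter fun n => MeasurableSet.iInter fun _ =>
    measurableSet_step n fun η ξ => ∃ v, ξ = create η v

omit [DecidableEq V] in
lemma measurableSet_tendsto_atTop (v : V) :
    MeasurableSet {h : ℕ → V → ℕ | Tendsto (fun k => h k v) atTop atTop} := by
  have : {h : ℕ → V → ℕ | Tendsto (fun k => h k v) atTop atTop} =
      ⋂ N, ⋃ m, ⋂ n, ⋂ (_ : n ≥ m), {h | h n ∈ {η : V → ℕ | N ≤ η v}} := by
    ext h; simp [tendsto_atTop_atTop]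
  rw [this]
  exact MeasurableSet.iInter fun _ => MeasurableSet.iUnion fun _ => MeasurableSet.iInter fun n =>
    MeasurableSet.iInter fun _ => measurableSet_eval_mem n _

end Trajectories

/-! ### No perpetual creation -/

section Recurrence

variable (G : SimpleGraph V) [DecidableRel G.Adj] (p q r : ℝ)

/-- The total rate of the transitions other than creations: annihilations and jumps. -/
noncomputable def removalRate (η : V → ℕ) : ℝ :=
  ∑ w, (removeWeight q (η w) + (G.degree w : ℝ) * removeWeight r (η w))

omit [DecidableEq V] in
lemma totalRate_eq (η : V → ℕ) :
    totalRate G p q r η = ∑ w, createWeight p (η w) + removalRate G q r η := by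
  rw [removalRate, ← Finset.sum_add_distrib]
  exact Finset.sum_congr rfl fun w _ => by ring

omit [DecidableEq V] in
/-- The rate of the creations at occupied sites is at most the number of particles times the
rate of the removals and jumps. -/
lemma sum_occupied_createWeight_le (hdeg : ∀ v, 1 ≤ G.degree v) (hp : p ≤ 1 + max q r)
    (η : V → ℕ) :
    ∑ v ∈ occupied η, createWeight p (η v) ≤ ((∑ w, η w : ℕ) : ℝ) * removalRate G q r η := by
  have hnn : ∀ w, 0 ≤ removeWeight q (η w) + (G.degree w : ℝ) * removeWeight r (η w) := fun w =>
    add_nonneg (removeWeight_nonneg _ _)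
      (mul_nonneg (Nat.cast_nonneg _) (removeWeight_nonneg _ _))
  rw [removalRate, Finset.mul_sum]
  refine (Finset.sum_le_sum fun v hv => ?_).trans
    (Finset.sum_le_sum_of_subset_of_nonneg (Finset.subset_univ (occupied η)) fun w _ _ =>
      mul_nonneg (Nat.cast_nonneg _) (hnn w))
  have hv0 : η v ≠ 0 := by simpa [occupied] using hv
  have hpos : (0 : ℝ) < η v := by exact_mod_cast Nat.pos_of_ne_zero hv0
  have h1 : (1 : ℝ) ≤ η v := by exact_mod_cast Nat.pos_of_ne_zero hv0
  have hN : (η v : ℝ) ≤ ((∑ w, η w : ℕ) : ℝ) := by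
    exact_mod_cast Finset.single_le_sum (fun w _ => Nat.zero_le (η w)) (Finset.mem_univ v)
  have hmax : (η v : ℝ) ^ max q r ≤
      removeWeight q (η v) + (G.degree v : ℝ) * removeWeight r (η v) := by
    have hd : (1 : ℝ) ≤ G.degree v := by exact_mod_cast hdeg v
    have hq := removeWeight_nonneg q (η v)
    have hr := removeWeight_nonneg r (η v)
    rcases max_choice q r with h | h
    · have : removeWeight q (η v) = (η v : ℝ) ^ q := by simp [removeWeight, hv0]
      rw [h, ← this]; nlinarith
    · have : removeWeight r (η v) = (η v : ℝ) ^ r := by simp [removeWeight, hv0]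
      rw [h, ← this]; nlinarith
  calc createWeight p (η v) = (η v : ℝ) ^ p := by simp [createWeight, hv0]
    _ ≤ (η v : ℝ) ^ (1 + max q r) := Real.rpow_le_rpow_of_exponent_le h1 hp
    _ = η v * (η v : ℝ) ^ max q r := by rw [Real.rpow_add hpos, Real.rpow_one]
    _ ≤ _ := mul_le_mul hN hmax (by positivity) (Nat.cast_nonneg _)

/-- From a configuration with `N` particles, the probability of `n` consecutive creations at
occupied sites is at most `(N + 1) / (N + 1 + n)`. -/
lemma iterate_creationKernel_occupied_le [Nonempty V] (hdeg : ∀ v, 1 ≤ G.degree v)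
    (hp : p ≤ 1 + max q r) (n : ℕ) (η : V → ℕ) :
    (creationKernel G p q r occupied)^[n] (Set.univ.indicator 1) η ≤
      (((∑ w, η w : ℕ) : ℝ) + 1) / (((∑ w, η w : ℕ) : ℝ) + 1 + n) := by
  refine iterate_creationKernel_le G p q r occupied
    (fun n η => (((∑ w, η w : ℕ) : ℝ) + 1) / (((∑ w, η w : ℕ) : ℝ) + 1 + n)) ?_ ?_ n η
  · intro η
    have : ((∑ w, η w : ℕ) : ℝ) + 1 ≠ 0 := by positivity
    simp [-Nat.cast_sum, this]
  · intro n η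
    have hA := sum_occupied_createWeight_le G p q r hdeg hp η
    have hZ := totalRate_pos G p q r η
    have hAZ : ∑ v ∈ occupied η, createWeight p (η v) + removalRate G q r η ≤
        totalRate G p q r η := by
      rw [totalRate_eq]
      gcongr
      · exact fun i _ _ => (createWeight_pos p _).le
      · exact Finset.subset_univ _
    simp only [creationKernel, sum_create]
    rw [← Finset.sum_mul, ← Finset.sum_div]
    set N : ℝ := ((∑ w, η w : ℕ) : ℝ) with hNdef
    have hN : 0 ≤ N := Nat.cast_nonneg _
    set A := ∑ v ∈ occupied η, createWeight p (η v)
    have hn : (0 : ℝ) ≤ n := Nat.cast_nonneg _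
    have hfrac : A / totalRate G p q r η ≤ N / (N + 1) := by
      rw [div_le_div_iff₀ hZ (by positivity)]
      nlinarith
    push_cast
    rw [← Nat.cast_sum, ← hNdef]
    calc A / totalRate G p q r η * ((N + 1 + 1) / (N + 1 + 1 + n))
        ≤ N / (N + 1) * ((N + 1 + 1) / (N + 1 + 1 + n)) := by gcongr
      _ ≤ (N + 1) / (N + 1 + (n + 1)) := by
        rw [div_mul_div_comm, div_le_div_iff₀ (by positivity) (by positivity)]
        have h3 : 0 ≤ N + 2 + n := by positivity
        nlinarith

lemma measure_creat_eq_zero [Nonempty V] (μ : Measure (ℕ → V → ℕ)) [IsProbabilityMeasure μ]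
    (hμ : ∀ n a, μ.real (pathCylinder (n + 1) a) =
      μ.real (pathCylinder n a) * transitionProb G p q r (a n) (a (n + 1)))
    (hdeg : ∀ v, 1 ≤ G.degree v) (hp : p ≤ 1 + max q r) : μ Creat = 0 := by
  have hsub : (Creat : Set (ℕ → V → ℕ)) ⊆ ⋃ m, ⋂ n, creating occupied m n := by
    intro h hh
    simpa using exists_creating_occupied hh
  refine measure_mono_null hsub (measure_iUnion_null fun m => ?_)
  refine measure_eq_zero_of_pathCylinder_bound μ
    (MeasurableSet.iInter fun n => measurableSet_creating _ _ _) m le_rfl one_pos fun l hl a => ?_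
  rw [zero_mul]
  have hlim : Tendsto (fun n : ℕ => μ.real (pathCylinder l a) *
      ((((∑ w, a l w : ℕ) : ℝ) + 1) / (((∑ w, a l w : ℕ) : ℝ) + 1 + n))) atTop (𝓝 0) := by
    rw [← mul_zero (μ.real (pathCylinder l a))]
    exact (tendsto_const_nhds.div_atTop
      (tendsto_atTop_add_const_left _ _ tendsto_natCast_atTop_atTop)).const_mul _
  refine ge_of_tendsto' hlim fun n => ?_
  calc μ.real ((⋂ n, creating occupied m n) ∩ pathCylinder l a)
      ≤ μ.real (pathCylinder l a ∩ creating occupied l n ∩ {h | h (l + n) ∈ Set.univ}) := by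
        refine measureReal_mono fun h hh => ⟨⟨hh.2, fun k hk hk' => ?_⟩, Set.mem_univ _⟩
        exact Set.mem_iInter.1 hh.1 (l + n) k (by omega) (by omega)
    _ ≤ _ := by
        rw [measureReal_pathCylinder_inter_creating G p q r occupied μ hμ]
        exact mul_le_mul_of_nonneg_left
          (iterate_creationKernel_occupied_le G p q r hdeg hp n _) measureReal_nonneg

end Recurrence

/-! ### Tails of series -/

section Tail

/-- The tail `∑_{j ≥ k} f j` of a series. -/
noncomputable def tail (f : ℕ → ℝ) (k : ℕ) : ℝ := ∑' j, f (j + k)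

lemma tail_eq {f : ℕ → ℝ} (hf : Summable f) (k : ℕ) : tail f k = f k + tail f (k + 1) := by
  have := ((summable_nat_add_iff k).2 hf).tsum_eq_zero_add
  rw [tail, this, zero_add, tail]
  congr 2
  ext j
  congr 1
  ring

lemma tail_nonneg {f : ℕ → ℝ} (h0 : ∀ k, 0 ≤ f k) (k : ℕ) : 0 ≤ tail f k :=
  tsum_nonneg fun _ => h0 _

lemma le_tail {f : ℕ → ℝ} (hf : Summable f) (h0 : ∀ k, 0 ≤ f k) (k : ℕ) : f k ≤ tail f k := by
  rw [tail_eq hf]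
  exact le_add_of_nonneg_right (tail_nonneg h0 _)

lemma tail_antitone {f : ℕ → ℝ} (hf : Summable f) (h0 : ∀ k, 0 ≤ f k) : Antitone (tail f) :=
  antitone_nat_of_succ_le fun k => by
    rw [tail_eq hf k]
    exact le_add_of_nonneg_left (h0 k)

lemma tendsto_tail (f : ℕ → ℝ) : Tendsto (tail f) atTop (𝓝 0) := tendsto_sum_nat_add f

end Tail

/-! ### Perpetual creation -/

section Transience

variable (G : SimpleGraph V) [DecidableRel G.Adj] (p q r : ℝ)

omit [DecidableEq V] in
/-- When `p` exceeds `σ = max q r 0`, the rate of removals and jumps from a configuration with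
`N` particles is at most a constant times `N ^ (-(p - σ))` times the rate of creations. -/
lemma removalRate_le [Nonempty V] (hp : max (max q r) 0 < p) (η : V → ℕ) :
    removalRate G q r η ≤
      ((∑ w, (1 + (G.degree w : ℝ))) * (Fintype.card V : ℝ) ^ p *
        ((∑ w, η w : ℕ) : ℝ) ^ (-(p - max (max q r) 0))) * ∑ w, createWeight p (η w) := by
  set σ := max (max q r) 0 with hσ
  have hσ0 : 0 ≤ σ := le_max_right _ _
  have hC : 0 ≤ ∑ w, (1 + (G.degree w : ℝ)) := Finset.sum_nonneg fun w _ => by positivity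
  have hApos : 0 < ∑ w, createWeight p (η w) :=
    Finset.sum_pos (fun w _ => createWeight_pos p _) Finset.univ_nonempty
  rcases Nat.eq_zero_or_pos (∑ w, η w) with h0 | hpos
  · have hη : ∀ w, η w = 0 := by simpa using h0
    have : removalRate G q r η = 0 := by simp [removalRate, removeWeight, hη]
    rw [this]
    positivity
  · set N : ℝ := ((∑ w, η w : ℕ) : ℝ) with hN
    have hN0 : 0 < N := Nat.cast_pos.2 hpos
    have hN1 : 1 ≤ N := Nat.one_le_cast.2 hpos
    have hd : (0 : ℝ) < Fintype.card V := by exact_mod_cast Fintype.card_pos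
    have hrem : ∀ s ≤ σ, ∀ w, removeWeight s (η w) ≤ N ^ σ := by
      intro s hs w
      unfold removeWeight
      split_ifs with hw
      · positivity
      · have h1 : (1 : ℝ) ≤ η w := by exact_mod_cast Nat.pos_of_ne_zero hw
        have h2 : (η w : ℝ) ≤ N :=
          Nat.cast_le.2 (Finset.single_le_sum (fun w _ => Nat.zero_le (η w)) (Finset.mem_univ w))
        exact (Real.rpow_le_rpow_of_exponent_le h1 hs).trans
          (Real.rpow_le_rpow (by positivity) h2 hσ0)
    have hB : removalRate G q r η ≤ (∑ w, (1 + (G.degree w : ℝ))) * N ^ σ := by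
      rw [removalRate, Finset.sum_mul]
      refine Finset.sum_le_sum fun w _ => ?_
      have h1 := hrem q ((le_max_left q r).trans (le_max_left _ _)) w
      have h2 := hrem r ((le_max_right q r).trans (le_max_left _ _)) w
      have h3 := mul_le_mul_of_nonneg_left h2 (Nat.cast_nonneg (α := ℝ) (G.degree w))
      linarith
    -- A fullest site carries at least the average number of particles.
    have hA : N ^ p ≤ (Fintype.card V : ℝ) ^ p * ∑ w, createWeight p (η w) := by
      obtain ⟨w, -, hw⟩ := Finset.exists_le_of_sum_le (s := (Finset.univ : Finset V))
        (f := fun _ => N / Fintype.card V) (g := fun w => (η w : ℝ)) Finset.univ_nonempty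
        (by
          rw [Finset.sum_const, Finset.card_univ, nsmul_eq_mul, mul_div_cancel₀ _ hd.ne', hN,
            Nat.cast_sum])
      have hw0 : η w ≠ 0 := by
        have : (0 : ℝ) < η w := (div_pos hN0 hd).trans_le hw
        exact_mod_cast this.ne'
      have hle : N ≤ Fintype.card V * η w := by
        rwa [div_le_iff₀' hd] at hw
      calc N ^ p ≤ (Fintype.card V * η w : ℝ) ^ p :=
            Real.rpow_le_rpow hN0.le hle (by linarith)
        _ = (Fintype.card V : ℝ) ^ p * createWeight p (η w) := by
            rw [Real.mul_rpow hd.le (Nat.cast_nonneg _)]; simp [createWeight, hw0]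
        _ ≤ _ := by
            gcongr
            exact Finset.single_le_sum (f := fun w => createWeight p (η w))
              (fun w _ => (createWeight_pos p _).le) (Finset.mem_univ w)
    calc removalRate G q r η ≤ (∑ w, (1 + (G.degree w : ℝ))) * N ^ σ := hB
      _ = (∑ w, (1 + (G.degree w : ℝ))) * (N ^ (-(p - σ)) * N ^ p) := by
          rw [← Real.rpow_add hN0]; congr 2; ring
      _ ≤ (∑ w, (1 + (G.degree w : ℝ))) * (N ^ (-(p - σ)) *
            ((Fintype.card V : ℝ) ^ p * ∑ w, createWeight p (η w))) := by
          gcongr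
      _ = _ := by ring

/-- When `p > 1 + max q r 0`, perpetual creation has a probability bounded away from zero,
uniformly in the initial configuration. -/
lemma exists_le_iterate_creationKernel_univ [Nonempty V] (hp : 1 + max (max q r) 0 < p) :
    ∃ δ : ℝ, 0 < δ ∧ ∀ (n : ℕ) (η : V → ℕ),
      δ ≤ (creationKernel G p q r fun _ => Finset.univ)^[n] (Set.univ.indicator 1) η := by
  set t := p - max (max q r) 0 with ht
  set C := (∑ w, (1 + (G.degree w : ℝ))) * (Fintype.card V : ℝ) ^ p with hCdef
  have hC : 0 ≤ C := mul_nonneg (Finset.sum_nonneg fun w _ => by positivity) (by positivity)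
  let f : ℕ → ℝ := fun k => (k : ℝ) ^ (-t)
  have hf : Summable f := Real.summable_nat_rpow.2 (by linarith)
  have hf0 : ∀ k, 0 ≤ f k := fun k => Real.rpow_nonneg (Nat.cast_nonneg k) _
  let g : (V → ℕ) → ℝ := fun η => Real.exp (-(C * tail f (∑ w, η w)))
  have hg1 : g ≤ Set.univ.indicator 1 := by
    intro η
    simp only [Set.indicator_univ, Pi.one_apply, g]
    exact Real.exp_le_one_iff.2 (neg_nonpos.2 (mul_nonneg hC (tail_nonneg hf0 _)))
  have hgK : g ≤ creationKernel G p q r (fun _ => Finset.univ) g := by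
    intro η
    have hZ := totalRate_pos G p q r η
    simp only [creationKernel, g, sum_create]
    rw [← Finset.sum_mul, ← Finset.sum_div, tail_eq hf (∑ w, η w), mul_add, neg_add,
      Real.exp_add]
    refine mul_le_mul_of_nonneg_right ?_ (Real.exp_pos _).le
    rw [le_div_iff₀ hZ, totalRate_eq, Real.exp_neg]
    have hB := removalRate_le G p q r (by linarith) η
    have hexp := Real.add_one_le_exp (C * f (∑ w, η w))
    have hApos : 0 < ∑ w, createWeight p (η w) :=
      Finset.sum_pos (fun w _ => createWeight_pos p _) Finset.univ_nonempty
    rw [inv_mul_le_iff₀ (Real.exp_pos _)]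
    have hB' : removalRate G q r η ≤ C * f (∑ w, η w) * ∑ w, createWeight p (η w) := hB
    nlinarith
  refine ⟨Real.exp (-(C * tail f 0)), Real.exp_pos _, fun n η => ?_⟩
  refine le_trans ?_ (le_iterate_creationKernel G p q r _ hg1 hgK n η)
  exact Real.exp_le_exp.2 (neg_le_neg
    (mul_le_mul_of_nonneg_left (tail_antitone hf hf0 (Nat.zero_le _)) hC))

lemma measure_compl_creat_eq_zero [Nonempty V] (μ : Measure (ℕ → V → ℕ)) [IsProbabilityMeasure μ]
    (hμ : ∀ n a, μ.real (pathCylinder (n + 1) a) =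
      μ.real (pathCylinder n a) * transitionProb G p q r (a n) (a (n + 1)))
    (hp : 1 + max (max q r) 0 < p) : μ Creatᶜ = 0 := by
  obtain ⟨δ, hδ, hK⟩ := exists_le_iterate_creationKernel_univ G p q r hp
  refine measure_eq_zero_of_pathCylinder_bound μ measurableSet_creat.compl 0
    (c := max (1 - δ) 0) (le_max_right _ _) (max_lt (by linarith) one_pos) fun m _ a => ?_
  let F : ℕ → Set (ℕ → V → ℕ) := fun n => pathCylinder m a ∩ creating (fun _ => Finset.univ) m n
  have hFm : ∀ n, MeasurableSet (F n) := fun n =>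
    (measurableSet_pathCylinder m a).inter (measurableSet_creating _ _ _)
  have hFanti : Antitone F := fun i j hij h hh =>
    ⟨hh.1, fun k hk hk' => hh.2 k hk (by omega)⟩
  have hF : ∀ n, δ * μ.real (pathCylinder m a) ≤ μ.real (F n) := by
    intro n
    have := measureReal_pathCylinder_inter_creating G p q r (fun _ => Finset.univ) μ hμ
      Set.univ n m a
    simp only [Set.mem_univ, Set.ofPred_true, Set.inter_univ] at this
    rw [show μ.real (F n) = _ from this, mul_comm]
    exact mul_le_mul_of_nonneg_left (hK n _) measureReal_nonneg
  have hlim : Tendsto (fun n => μ.real (F n)) atTop (𝓝 (μ.real (⋂ n, F n))) :=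
    (ENNReal.tendsto_toReal (measure_ne_top _ _)).comp
      (tendsto_measure_iInter_atTop (fun n => (hFm n).nullMeasurableSet) hFanti
        ⟨0, measure_ne_top _ _⟩)
  have hge : δ * μ.real (pathCylinder m a) ≤ μ.real (⋂ n, F n) := ge_of_tendsto' hlim hF
  have hsub : (⋂ n, F n) ⊆ pathCylinder m a ∩ Creat := by
    intro h hh
    rw [Set.mem_iInter] at hh
    refine ⟨(hh 0).1, m, fun n hn => ?_⟩
    obtain ⟨v, -, hv⟩ := (hh (n + 1 - m)).2 n hn (by omega)
    exact ⟨v, hv⟩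
  have hsplit := measureReal_inter_add_sdiff (μ := μ) (s := pathCylinder m a) measurableSet_creat
  rw [Set.sdiff_eq, Set.inter_comm _ Creatᶜ] at hsplit
  have hle := measureReal_mono (μ := μ) hsub
  have hmax : (1 - δ) * μ.real (pathCylinder m a) ≤ max (1 - δ) 0 * μ.real (pathCylinder m a) := by
    gcongr
    exact le_max_left _ _
  linarith

end Transience

/-! ### Two sites do not both grow indefinitely -/

section Monopoly

/-- The quadratic form in `M = D ^ 2 + S` and `S` that dominates `M ^ 2` and is a supermartingale
along creations. -/
def quadForm (D S : ℝ) : ℝ := (D ^ 2 + S) ^ 2 + 8 * (D ^ 2 + S) * S + 8 * S ^ 2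

/-- The drift of `quadForm` under creations at the two sites, which have rates `a⁻¹` and `b⁻¹`
and move `D` by `a` and `-b`. -/
lemma quadForm_drift {a b D S : ℝ} (ha : 0 < a) (hb : 0 < b) (hS : a ^ 2 + b ^ 2 ≤ S) :
    a⁻¹ * (quadForm (D + a) (S - a ^ 2) - quadForm D S) +
      b⁻¹ * (quadForm (D - b) (S - b ^ 2) - quadForm D S) ≤ 0 := by
  have h : a⁻¹ * (quadForm (D + a) (S - a ^ 2) - quadForm D S) +
      b⁻¹ * (quadForm (D - b) (S - b ^ 2) - quadForm D S) =
      -((a + b) * (4 * (D + 2 * (a - b)) ^ 2 + 24 * (S - a ^ 2 - b ^ 2) + 32 * (a * b))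
        + 8 * (a ^ 2 * b + a * b ^ 2)) := by
    unfold quadForm
    field_simp
    ring
  rw [h, neg_nonpos]
  have : 0 ≤ S - a ^ 2 - b ^ 2 := by linarith
  positivity

/-- Along creations at the two sites, `M = D ^ 2 + S` is a martingale. -/
lemma martingale_drift {a b D S : ℝ} (ha : 0 < a) (hb : 0 < b) :
    a⁻¹ * (((D + a) ^ 2 + (S - a ^ 2)) - (D ^ 2 + S)) +
      b⁻¹ * (((D - b) ^ 2 + (S - b ^ 2)) - (D ^ 2 + S)) = 0 := by
  field_simp
  ring

lemma sq_le_quadForm {D S : ℝ} (hS : 0 ≤ S) : (D ^ 2 + S) ^ 2 ≤ quadForm D S := by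
  unfold quadForm
  have : 0 ≤ 8 * (D ^ 2 + S) * S + 8 * S ^ 2 := by positivity
  linarith

lemma quadForm_le {D S : ℝ} (hS : 0 ≤ S) : quadForm D S ≤ 17 * (D ^ 2 + S) ^ 2 := by
  unfold quadForm
  nlinarith [mul_nonneg (sq_nonneg D) hS, mul_nonneg (sq_nonneg D) (sq_nonneg D)]

variable (G : SimpleGraph V) [DecidableRel G.Adj] (p q r : ℝ)

/-- A nonnegative function with nonpositive drift under creations is superharmonic for the
creation kernel. -/
lemma creationKernel_le_self [Nonempty V] {g : (V → ℕ) → ℝ} (h0 : ∀ η, 0 ≤ g η)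
    (hdrift : ∀ η, ∑ w, createWeight p (η w) * (g (create η w) - g η) ≤ 0) :
    creationKernel G p q r (fun _ => Finset.univ) g ≤ g := by
  intro η
  have hZ := totalRate_pos G p q r η
  have hA := mul_le_mul_of_nonneg_right (sum_createWeight_le_totalRate G p q r η) (h0 η)
  have hd := hdrift η
  simp only [mul_sub, Finset.sum_sub_distrib, ← Finset.sum_mul] at hd
  have : creationKernel G p q r (fun _ => Finset.univ) g η =
      (∑ w, createWeight p (η w) * g (create η w)) / totalRate G p q r η := by
    rw [creationKernel, Finset.sum_div]
    exact Finset.sum_congr rfl fun w _ => by ring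
  rw [this, div_le_iff₀ hZ]
  linarith

/-- The inverse creation weight. -/
noncomputable def invWeight (p : ℝ) (k : ℕ) : ℝ := (createWeight p k)⁻¹

lemma invWeight_pos (p : ℝ) (k : ℕ) : 0 < invWeight p k := inv_pos.2 (createWeight_pos p k)

lemma summable_invWeight (hp : 1 < p) : Summable (invWeight p) := by
  rw [← summable_nat_add_iff 1]
  refine ((summable_nat_add_iff 1).2 (Real.summable_nat_rpow.2 (neg_lt_neg hp))).congr fun k => ?_
  rw [invWeight, createWeight, if_neg (by omega), Real.rpow_neg (Nat.cast_nonneg _)]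

lemma summable_invWeight_sq (hp : 1 < p) : Summable fun k => invWeight p k ^ 2 := by
  refine Summable.of_nonneg_of_le (fun k => sq_nonneg _) (fun k => ?_) (summable_invWeight p hp)
  have h1 : invWeight p k ≤ 1 := by
    refine inv_le_one_of_one_le₀ ?_
    unfold createWeight
    split_ifs with hk
    · exact le_rfl
    · exact Real.one_le_rpow (by exact_mod_cast Nat.pos_of_ne_zero hk) (by linarith)
  have := invWeight_pos p k
  nlinarith

/-- The difference `∑_{j ≥ η v} j ^ (-p) - ∑_{j ≥ η u} j ^ (-p)` (where `0 ^ (-p) = 1`), a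
martingale along creations. -/
noncomputable def gap (u v : V) (η : V → ℕ) : ℝ :=
  tail (invWeight p) (η v) - tail (invWeight p) (η u)

/-- The sum of the squares of all future increments of the gap, should both sites grow
indefinitely. -/
noncomputable def spread (u v : V) (η : V → ℕ) : ℝ :=
  tail (fun k => invWeight p k ^ 2) (η u) + tail (fun k => invWeight p k ^ 2) (η v)

omit [Fintype V] [DecidableEq V] in
lemma sq_add_sq_le_spread (hp : 1 < p) (u v : V) (η : V → ℕ) :
    invWeight p (η u) ^ 2 + invWeight p (η v) ^ 2 ≤ spread p u v η :=
  add_le_add (le_tail (summable_invWeight_sq p hp) (fun _ => sq_nonneg _) _)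
    (le_tail (summable_invWeight_sq p hp) (fun _ => sq_nonneg _) _)

omit [Fintype V] [DecidableEq V] in
lemma spread_pos (hp : 1 < p) (u v : V) (η : V → ℕ) : 0 < spread p u v η := by
  have h1 := invWeight_pos p (η u)
  have h2 := invWeight_pos p (η v)
  exact (by positivity : 0 < invWeight p (η u) ^ 2 + invWeight p (η v) ^ 2).trans_le
    (sq_add_sq_le_spread p hp u v η)

omit [Fintype V] in
lemma gap_spread_create (hp : 1 < p) {u v : V} (huv : u ≠ v) (η : V → ℕ) :
    (gap p u v (create η u) = gap p u v η + invWeight p (η u) ∧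
      spread p u v (create η u) = spread p u v η - invWeight p (η u) ^ 2) ∧
    (gap p u v (create η v) = gap p u v η - invWeight p (η v) ∧
      spread p u v (create η v) = spread p u v η - invWeight p (η v) ^ 2) ∧
    ∀ w, w ≠ u → w ≠ v → gap p u v (create η w) = gap p u v η ∧
      spread p u v (create η w) = spread p u v η := by
  have h1 := fun k => tail_eq (summable_invWeight p hp) k
  have h2 := fun k => tail_eq (summable_invWeight_sq p hp) k
  refine ⟨⟨?_, ?_⟩, ⟨?_, ?_⟩, fun w hu hv => ⟨?_, ?_⟩⟩
  · simp only [gap, create, update_self, update_of_ne huv.symm]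
    rw [h1 (η u)]; ring
  · simp only [spread, create, update_self, update_of_ne huv.symm]
    rw [h2 (η u)]; ring
  · simp only [gap, create, update_self, update_of_ne huv]
    rw [h1 (η v)]; ring
  · simp only [spread, create, update_self, update_of_ne huv]
    rw [h2 (η v)]; ring
  · simp only [gap, create, update_of_ne hu.symm, update_of_ne hv.symm]
  · simp only [spread, create, update_of_ne hu.symm, update_of_ne hv.symm]

/-- With `M = gap ^ 2 + spread`, the function `1 - 2 κ M + κ ^ 2 W`, where `W ≥ M ^ 2` is the
supermartingale `quadForm`. It dominates `(1 - κ M) ^ 2` and tends to `1` when both sites grow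
indefinitely. -/
noncomputable def barrier (u v : V) (κ : ℝ) (η : V → ℕ) : ℝ :=
  1 - 2 * κ * (gap p u v η ^ 2 + spread p u v η)
    + κ ^ 2 * quadForm (gap p u v η) (spread p u v η)

omit [Fintype V] [DecidableEq V] in
lemma barrier_nonneg (hp : 1 < p) (u v : V) (κ : ℝ) (η : V → ℕ) : 0 ≤ barrier p u v κ η := by
  have h := mul_le_mul_of_nonneg_left
    (sq_le_quadForm (D := gap p u v η) (spread_pos p hp u v η).le) (sq_nonneg κ)
  unfold barrier
  nlinarith [sq_nonneg (1 - κ * (gap p u v η ^ 2 + spread p u v η))]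

lemma creationKernel_barrier_le [Nonempty V] (hp : 1 < p) {u v : V} (huv : u ≠ v) (κ : ℝ) :
    creationKernel G p q r (fun _ => Finset.univ) (barrier p u v κ) ≤ barrier p u v κ := by
  refine creationKernel_le_self G p q r (barrier_nonneg p hp u v κ) fun η => ?_
  obtain ⟨⟨hu1, hu2⟩, ⟨hv1, hv2⟩, hw⟩ := gap_spread_create p hp huv η
  rw [← Finset.sum_subset (Finset.subset_univ {u, v}), Finset.sum_pair huv]
  · have ha := invWeight_pos p (η u)
    have hb := invWeight_pos p (η v)
    have h1 := martingale_drift (D := gap p u v η) (S := spread p u v η) ha hb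
    have h2 := mul_le_mul_of_nonneg_left
      (quadForm_drift (D := gap p u v η) ha hb (sq_add_sq_le_spread p hp u v η)) (sq_nonneg κ)
    rw [show createWeight p (η u) = (invWeight p (η u))⁻¹ from (inv_inv _).symm,
      show createWeight p (η v) = (invWeight p (η v))⁻¹ from (inv_inv _).symm]
    simp only [barrier, hu1, hu2, hv1, hv2]
    linear_combination h2 - 2 * κ * h1
  · intro w _ hwuv
    simp only [Finset.mem_insert, Finset.mem_singleton, not_or] at hwuv
    obtain ⟨h1, h2⟩ := hw w hwuv.1 hwuv.2
    simp [barrier, h1, h2]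

omit [Fintype V] [DecidableEq V] in
/-- For a suitable `κ` the barrier is at most `1 - 1 / 17` at a given configuration: this is the
second moment method for `M`, since `W ≤ 17 M ^ 2`. -/
lemma exists_barrier_le (hp : 1 < p) (u v : V) (η : V → ℕ) :
    ∃ κ, barrier p u v κ η ≤ 16 / 17 := by
  have hS := spread_pos p hp u v η
  have hM : 0 < gap p u v η ^ 2 + spread p u v η := by positivity
  refine ⟨(17 * (gap p u v η ^ 2 + spread p u v η))⁻¹, ?_⟩
  have hW := quadForm_le (D := gap p u v η) hS.le
  unfold barrier
  set M := gap p u v η ^ 2 + spread p u v η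
  have h1 : 2 * (17 * M)⁻¹ * M = 2 / 17 := by field_simp
  have h2 : (17 * M)⁻¹ ^ 2 * (17 * M ^ 2) = 1 / 17 := by field_simp
  have h3 := mul_le_mul_of_nonneg_left hW (sq_nonneg (17 * M)⁻¹)
  linarith

omit [Fintype V] [DecidableEq V] in
lemma tendsto_barrier {h : ℕ → V → ℕ} {u v : V} (hu : Tendsto (fun k => h k u) atTop atTop)
    (hv : Tendsto (fun k => h k v) atTop atTop) (κ : ℝ) :
    Tendsto (fun k => barrier p u v κ (h k)) atTop (𝓝 1) := by
  have hD : Tendsto (fun k => gap p u v (h k)) atTop (𝓝 0) := by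
    simpa [gap, comp_def] using ((tendsto_tail (invWeight p)).comp hv).sub
      ((tendsto_tail (invWeight p)).comp hu)
  have hS : Tendsto (fun k => spread p u v (h k)) atTop (𝓝 0) := by
    simpa [spread, comp_def] using ((tendsto_tail fun k => invWeight p k ^ 2).comp hu).add
      ((tendsto_tail fun k => invWeight p k ^ 2).comp hv)
  have hcont : Continuous fun x : ℝ × ℝ =>
      1 - 2 * κ * (x.1 ^ 2 + x.2) + κ ^ 2 * quadForm x.1 x.2 := by
    unfold quadForm
    fun_prop
  have := (hcont.tendsto (0, 0)).comp (hD.prodMk_nhds hS)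
  simpa [barrier, quadForm, comp_def] using this

/-- The trajectories along which, from time `m` on, only creations occur, and both `u` and `v`
receive infinitely many particles. -/
def jointGrowth (m : ℕ) (u v : V) : Set (ℕ → V → ℕ) :=
  (⋂ n, creating (fun _ => Finset.univ) m n) ∩
    ({h | Tendsto (fun k => h k u) atTop atTop} ∩ {h | Tendsto (fun k => h k v) atTop atTop})

lemma measure_jointGrowth_eq_zero [Nonempty V] (μ : Measure (ℕ → V → ℕ)) [IsProbabilityMeasure μ]
    (hμ : ∀ n a, μ.real (pathCylinder (n + 1) a) =
      μ.real (pathCylinder n a) * transitionProb G p q r (a n) (a (n + 1)))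
    (hp : 1 < p) {u v : V} (huv : u ≠ v) (m : ℕ) : μ (jointGrowth m u v) = 0 := by
  refine measure_eq_zero_of_pathCylinder_bound μ (E := jointGrowth m u v)
    ((MeasurableSet.iInter fun n => measurableSet_creating _ _ _).inter
      ((measurableSet_tendsto_atTop u).inter (measurableSet_tendsto_atTop v))) m
    (c := 32 / 33) (by norm_num) (by norm_num) fun n hn a => ?_
  obtain ⟨κ, hκ⟩ := exists_barrier_le p hp u v (a n)
  let D : Set (V → ℕ) := {η | 33 / 34 ≤ barrier p u v κ η}
  let F : ℕ → Set (ℕ → V → ℕ) := fun k =>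
    pathCylinder n a ∩ creating (fun _ => Finset.univ) n k ∩ {h | h (n + k) ∈ D}
  -- Markov's inequality for the barrier, at the threshold `33 / 34 > 16 / 17`.
  have hF : ∀ k, μ.real (F k) ≤ 32 / 33 * μ.real (pathCylinder n a) := by
    intro k
    have hit : (creationKernel G p q r fun _ => Finset.univ)^[k] (D.indicator 1) ≤
        fun η => 34 / 33 * barrier p u v κ η := by
      refine iterate_creationKernel_le G p q r _ (fun _ η => 34 / 33 * barrier p u v κ η) ?_
        (fun _ η => ?_) k
      · refine Set.indicator_le' (fun η hη => ?_) fun η _ => ?_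
        · have : 33 / 34 ≤ barrier p u v κ η := hη
          change (1 : ℝ) ≤ 34 / 33 * barrier p u v κ η
          linarith
        · have := barrier_nonneg p hp u v κ η
          change (0 : ℝ) ≤ 34 / 33 * barrier p u v κ η
          positivity
      · have := creationKernel_barrier_le G p q r hp huv κ η
        calc creationKernel G p q r (fun _ => Finset.univ) (fun η => 34 / 33 * barrier p u v κ η) η
            = 34 / 33 * creationKernel G p q r (fun _ => Finset.univ) (barrier p u v κ) η := by
              simp only [creationKernel, Finset.mul_sum]
              exact Finset.sum_congr rfl fun w _ => by ring
          _ ≤ 34 / 33 * barrier p u v κ η := mul_le_mul_of_nonneg_left this (by norm_num)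
    rw [show μ.real (F k) = _ from measureReal_pathCylinder_inter_creating G p q r _ μ hμ D k n a,
      mul_comm]
    refine mul_le_mul_of_nonneg_right ((hit (a n)).trans ?_) measureReal_nonneg
    linarith
  have hsub : jointGrowth m u v ∩ pathCylinder n a ⊆ ⋃ N, ⋂ k, ⋂ (_ : N ≤ k), F k := by
    rintro h ⟨⟨hc, hu, hv⟩, ha⟩
    have hev := (tendsto_barrier p hu hv κ).eventually
      (eventually_ge_nhds (by norm_num : (33 / 34 : ℝ) < 1))
    obtain ⟨N, hN⟩ := eventually_atTop.1 hev
    simp only [Set.mem_iUnion, Set.mem_iInter]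
    refine ⟨N, fun k hk => ⟨⟨ha, fun j hj hj' => ?_⟩, hN (n + k) (by omega)⟩⟩
    exact Set.mem_iInter.1 hc (n + k) j (by omega) (by omega)
  have hmono : Monotone fun N => ⋂ k, ⋂ (_ : N ≤ k), F k := fun i j hij =>
    Set.iInter_mono fun k => Set.iInter_mono' fun hk => ⟨hij.trans hk, subset_rfl⟩
  have hlim : Tendsto (fun N => μ.real (⋂ k, ⋂ (_ : N ≤ k), F k)) atTop
      (𝓝 (μ.real (⋃ N, ⋂ k, ⋂ (_ : N ≤ k), F k))) :=
    (ENNReal.tendsto_toReal (measure_ne_top _ _)).comp (tendsto_measure_iUnion_atTop hmono)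
  refine (measureReal_mono hsub).trans (le_of_tendsto' hlim fun N => ?_)
  exact (measureReal_mono (Set.iInter₂_subset N le_rfl)).trans (hF N)

lemma measure_compl_mon_eq_zero [Nonempty V] (μ : Measure (ℕ → V → ℕ)) [IsProbabilityMeasure μ]
    (hμ : ∀ n a, μ.real (pathCylinder (n + 1) a) =
      μ.real (pathCylinder n a) * transitionProb G p q r (a n) (a (n + 1)))
    (hp : 1 + max (max q r) 0 < p) : μ Monᶜ = 0 := by
  have hp1 : 1 < p := by linarith [le_max_right (max q r) 0]
  have hsub : (Mon : Set (ℕ → V → ℕ))ᶜ ⊆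
      Creatᶜ ∪ ⋃ m, ⋃ u, ⋃ v, ⋃ (_ : u ≠ v), jointGrowth m u v := by
    intro h hh
    by_contra hcon
    simp only [Set.mem_union, Set.mem_compl_iff, Set.mem_iUnion, not_or, not_not,
      not_exists] at hcon
    obtain ⟨hc, hj⟩ := hcon
    refine hh (mem_mon_of_creat hc fun u v huv hboth => ?_)
    obtain ⟨m, hm⟩ := hc
    refine hj m u v huv ⟨Set.mem_iInter.2 fun n k hk _ => ?_, hboth⟩
    obtain ⟨w, hw⟩ := hm k hk
    exact ⟨w, Finset.mem_univ w, hw⟩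
  refine measure_mono_null hsub (measure_union_null
    (measure_compl_creat_eq_zero G p q r μ hμ hp) ?_)
  exact measure_iUnion_null fun m => measure_iUnion_null fun u => measure_iUnion_null fun v =>
    measure_iUnion_null fun huv => measure_jointGrowth_eq_zero G p q r μ hμ hp1 huv m

end Monopoly

/-! ### The law of the trajectory -/

section PathLaw

variable (G : SimpleGraph V) [DecidableRel G.Adj] (p q r : ℝ)

omit [Fintype V] [DecidableEq V] in
lemma measurable_path {Ω : Type*} [MeasurableSpace Ω] {H : ℕ → Ω → V → ℕ}
    (hH : ∀ n, Measurable (H n)) : Measurable fun ω n => H n ω :=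
  measurable_pi_lambda _ hH

lemma map_path_pathCylinder {Ω : Type*} [MeasurableSpace Ω] {P : Measure Ω} {H : ℕ → Ω → V → ℕ}
    (hH : IsNCZR G p q r P H) (n : ℕ) (a : ℕ → V → ℕ) :
    (P.map fun ω n => H n ω).real (pathCylinder (n + 1) a) =
      (P.map fun ω n => H n ω).real (pathCylinder n a) *
        transitionProb G p q r (a n) (a (n + 1)) := by
  rw [map_measureReal_apply (measurable_path hH.measurable) (measurableSet_pathCylinder _ _),
    map_measureReal_apply (measurable_path hH.measurable) (measurableSet_pathCylinder _ _)]
  exact hH.markov n a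

end PathLaw

end NCZR

theorem theorem1p1 {V : Type*} [Fintype V] [DecidableEq V]
    (G : SimpleGraph V) [DecidableRel G.Adj] (hG : G.Connected) (p q r : ℝ)
    {Ω : Type*} [MeasurableSpace Ω] (P : Measure Ω) [IsProbabilityMeasure P]
    (H : ℕ → Ω → V → ℕ) (hH : NCZR.IsNCZR G p q r P H) :
    (Nontrivial V → p ≤ 1 + max q r →
      P {ω | (fun n => H n ω) ∈ NCZR.Creat} = 0) ∧
    (p > 1 + max (max q r) 0 →
      P {ω | (fun n => H n ω) ∈ NCZR.Creat} = 1 ∧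
      P {ω | (fun n => H n ω) ∈ NCZR.Mon} = 1) := by
  have : Nonempty V := hG.nonempty
  have hΦ := NCZR.measurable_path hH.measurable
  have := Measure.isProbabilityMeasure_map (μ := P) hΦ.aemeasurable
  have hμ := NCZR.map_path_pathCylinder G p q r hH
  refine ⟨fun hV hp => ?_, fun hp => ?_⟩
  · have hdeg : ∀ v, 1 ≤ G.degree v := fun v => hG.preconnected.degree_pos_of_nontrivial v
    exact nonpos_iff_eq_zero.1 ((Measure.le_map_apply hΦ.aemeasurable _).trans
      (NCZR.measure_creat_eq_zero G p q r _ hμ hdeg hp).le)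
  · have hMon : ∀ᵐ ω ∂P, (fun n => H n ω) ∈ NCZR.Mon :=
      ae_of_ae_map hΦ.aemeasurable (NCZR.measure_compl_mon_eq_zero G p q r _ hμ hp)
    have hCreat : ∀ᵐ ω ∂P, (fun n => H n ω) ∈ NCZR.Creat :=
      hMon.mono fun _ h => NCZR.mon_subset_creat h
    constructor
    · rw [measure_congr (eventuallyEq_univ.2 hCreat), measure_univ]
    · rw [measure_congr (eventuallyEq_univ.2 hMon), measure_univ]
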